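/- Let $\mathcal X,\mathcal Y$ be finite sets of types of men and women, let $\mathcal A=(\mathcal X\times\mathcal Y)\cup(\mathcal X\times\{0\})\cup(\{0\}\times\mathcal Y)$ be the set of household types (couples, single men, single women), and let $w\in\mathbb R^{\mathcal A}$ be the household sizes: $w_{xy}=2$, $w_{x0}=w_{0y}=1$; put $W=\mathrm{diag}(w)$. Let $\phi\in\mathbb R^{(\mathcal X\times\mathcal Y)\times K}$ be a matrix of $K$ basis functions with linearly independent columns, and let $Z$ be the $|\mathcal A|\times(K+|\mathcal X|+|\mathcal Y|)$ matrix such that, for $\gamma=(\beta,a,b)$, $(Z\gamma)_{xy}=\tfrac12(\phi_{xy}\cdot\beta-a_x-b_y)$, $(Z\gamma)_{x0}=-a_x$, $(Z\gamma)_{0y}=-b_y$; write $Z_a$ for its row $a\in\mathcal A$ (a row vector). For $m\in\mathbb R^{\mathcal A}$, a solution of the weighted Poisson regression of $m$ on $Z$ is a maximizer over $\gamma$ of $$\sum_{a\in\mathcal A}w_am_a(Z\gamma)_a-\sum_{a\in\mathcal A}w_a\exp((Z\gamma)_a).$$ Let $\mu\in\mathbb R^{\mathcal A}$ have positive entries with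 sum $1$, let $\hat\mu=\hat\mu_N$ be the vector of observed frequencies in $N$ independent draws of households from $\mu$, and let $\hat\gamma=\hat\gamma_N=(\hat\beta,\hat a,\hat b)$ be a function of $\hat\mu_N$ that solves the Poisson regression of $\hat\mu_N$ on $Z$ whenever a solution exists (almost surely, one exists for all large $N$). Put $$\hat A=Z^\top W\,\mathrm{diag}(\exp(Z\hat\gamma))\,Z=\sum_{a\in\mathcal A}w_a\exp(Z_a\hat\gamma)\,Z_a^\top Z_a,$$ $$\hat B=Z^\top W(\mathrm{diag}(\hat\mu)-\hat\mu\hat\mu^\top)WZ=\sum_{a\in\mathcal A}w_a^2\hat\mu_a\,Z_a^\top Z_a-\sum_{a,a'\in\mathcal A}w_aw_{a'}\hat\mu_a\hat\mu_{a'}\,Z_a^\top Z_{a'}.$$ Then $\hat A$ is invertible; the Poisson regression of $\mu$ on $Z$ has a unique solution $\gamma_0$; and there is a positive semidefinite matrix $V$ such that, as $N\to\infty$, $\sqrt N(\hat\gamma_N-\gamma_0)$ converges in distribution to $\mathcal N(0,V)$ (so $V$ is the asymptotic variance-covariance matrix of $\hat\gamma$) and $$\hat A^{-1}\hat B\hat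 A^{-1}\longrightarrow V\quad\text{in probability, entry by entry.}$$ Moreover, if $\mu$ is the stable matching of the Choo and Siow model with joint surplus $\Phi=\phi\beta$, then $\gamma_0=(\beta,a,b)$ with this $\beta$, and $\mu_a=\exp((Z\gamma_0)_a)$ for all $a\in\mathcal A$. (Stability means: there are $U,V'\in\mathbb R^{\mathcal X\times\mathcal Y}$ with $U+V'=\Phi$ such that $\mu$ is at once what men demand when a man of type $x$ chooses $y\in\mathcal Y\cup\{0\}$ to maximize $U_{xy}+\varepsilon_y$, and what women demand when a woman of type $y$ chooses $x\in\mathcal X\cup\{0\}$ to maximize $V'_{xy}+\eta_x$, with $U_{x0}=V'_{0y}=0$, i.i.d. standard type I extreme value $\varepsilon,\eta$, and masses $n_x=\mu_{x0}+\sum_y\mu_{xy}$ of men and $m_y=\mu_{0y}+\sum_x\mu_{xy}$ of women.) -/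

import Mathlib

open MeasureTheory ProbabilityTheory Filter Topology

/-- The set of marital arrangements: couples `(x, y)`, single men `x`, single women `y`. -/
abbrev Arrangement (X Y : Type*) : Type _ := (X × Y) ⊕ X ⊕ Y

/-- Indices of the parameter vector `γ = (β, a, b)`. -/
abbrev ParamIdx (K X Y : Type*) : Type _ := K ⊕ X ⊕ Y

noncomputable section

/-! ### The large Choo and Siow market -/

/-- The standard type I extreme value (Gumbel) distribution on the real line. -/
def gumbel : Measure ℝ :=
  volume.withDensity fun t => ENNReal.ofReal (Real.exp (-t - Real.exp (-t)))

/-- Probability that option `o` is optimal among `Option ι` (`none` is singlehood, with systematic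
utility zero) when the random utility terms are i.i.d. standard type I extreme value. -/
def choiceProb {ι : Type*} [Fintype ι] (U : ι → ℝ) (o : Option ι) : ℝ :=
  (Measure.pi fun _ : Option ι => gumbel).real
    {ε | ∀ o' : Option ι, o'.elim 0 U + ε o' ≤ o.elim 0 U + ε o}

/-- Mass of men of type `x`. -/
def menMargin {X Y : Type*} [Fintype Y] (μ : Arrangement X Y → ℝ) (x : X) : ℝ :=
  μ (.inr (.inl x)) + ∑ y, μ (.inl (x, y))

/-- Mass of women of type `y`. -/
def womenMargin {X Y : Type*} [Fintype X] (μ : Arrangement X Y → ℝ) (y : Y) : ℝ :=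
  μ (.inr (.inr y)) + ∑ x, μ (.inl (x, y))

/-- `μ` is a stable matching of the Choo and Siow market with joint surplus `Φ`: the surplus splits
as `Φ = U + V`, and `μ` is what men and women demand when a man of type `x` maximizes
`U x y + ε y` and a woman of type `y` maximizes `V x y + η x` (both over partner types and
singlehood), with i.i.d. standard type I extreme value `ε`, `η`. -/
def IsChooSiowStable {X Y : Type*} [Fintype X] [Fintype Y]
    (Φ : X × Y → ℝ) (μ : Arrangement X Y → ℝ) : Prop :=
  ∃ U V : X → Y → ℝ,
    (∀ x y, U x y + V x y = Φ (x, y)) ∧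
    (∀ x y, μ (.inl (x, y)) = menMargin μ x * choiceProb (fun y' => U x y') (some y)) ∧
    (∀ x, μ (.inr (.inl x)) = menMargin μ x * choiceProb (fun y' => U x y') none) ∧
    (∀ x y, μ (.inl (x, y)) = womenMargin μ y * choiceProb (fun x' => V x' y) (some x)) ∧
    (∀ y, μ (.inr (.inr y)) = womenMargin μ y * choiceProb (fun x' => V x' y) none)

/-! ### The weighted Poisson regression -/

/-- Household size: two for couples, one for singles. -/
def hhSize {X Y : Type*} : Arrangement X Y → ℝ
  | .inl _ => 2
  | .inr _ => 1

/-- The design matrix `Z`, with rows ordered as couples, single men, single women, and columns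
ordered as basis functions, men's fixed effects, women's fixed effects. -/
def design {X Y K : Type*} [DecidableEq X] [DecidableEq Y] (φ : Matrix (X × Y) K ℝ) :
    Matrix (Arrangement X Y) (ParamIdx K X Y) ℝ :=
  Matrix.of fun r c => match r, c with
    | .inl xy, .inl k => φ xy k / 2
    | .inl xy, .inr (.inl x') => if xy.1 = x' then -1 / 2 else 0
    | .inl xy, .inr (.inr y') => if xy.2 = y' then -1 / 2 else 0
    | .inr (.inl x), .inr (.inl x') => if x = x' then -1 else 0
    | .inr (.inr y), .inr (.inr y') => if y = y' then -1 else 0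
    | .inr _, _ => 0

section

variable {X Y K : Type*} [Fintype X] [Fintype Y] [Fintype K] [DecidableEq X] [DecidableEq Y]

open Matrix

/-- The objective function of the weighted Poisson regression of `m` on `Z`. -/
def poissonObjective (φ : Matrix (X × Y) K ℝ) (m : Arrangement X Y → ℝ)
    (γ : ParamIdx K X Y → ℝ) : ℝ :=
  ∑ a, hhSize a * m a * (design φ *ᵥ γ) a - ∑ a, hhSize a * Real.exp ((design φ *ᵥ γ) a)

/-- `γ` is a solution of the weighted Poisson regression of `m` on `Z`. -/
def IsPoissonSolution (φ : Matrix (X × Y) K ℝ) (m : Arrangement X Y → ℝ)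
    (γ : ParamIdx K X Y → ℝ) : Prop :=
  IsMaxOn (poissonObjective φ m) Set.univ γ

/-- The matrix `W = diag(w)` of household sizes. -/
def weightMatrix (X Y : Type*) [DecidableEq X] [DecidableEq Y] :
    Matrix (Arrangement X Y) (Arrangement X Y) ℝ :=
  diagonal hhSize

/-- The matrix `Zᵀ W diag(exp(Zγ)) Z`. -/
def matrixA (φ : Matrix (X × Y) K ℝ) (γ : ParamIdx K X Y → ℝ) :
    Matrix (ParamIdx K X Y) (ParamIdx K X Y) ℝ :=
  (design φ)ᵀ * weightMatrix X Y * diagonal (fun a => Real.exp ((design φ *ᵥ γ) a)) * design φ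

/-- The matrix `Zᵀ W (diag(m) - m mᵀ) W Z`. -/
def matrixB (φ : Matrix (X × Y) K ℝ) (m : Arrangement X Y → ℝ) :
    Matrix (ParamIdx K X Y) (ParamIdx K X Y) ℝ :=
  (design φ)ᵀ * weightMatrix X Y * (diagonal m - vecMulVec m m) * weightMatrix X Y * design φ

/-- The sandwich `A⁻¹ B A⁻¹`. -/
def sandwich [DecidableEq K] (φ : Matrix (X × Y) K ℝ) (γ : ParamIdx K X Y → ℝ)
    (m : Arrangement X Y → ℝ) : Matrix (ParamIdx K X Y) (ParamIdx K X Y) ℝ :=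
  (matrixA φ γ)⁻¹ * matrixB φ m * (matrixA φ γ)⁻¹

end

/-! ### Sampling and asymptotic variance -/

/-- `ξ 0, ξ 1, …` are i.i.d. draws of households from the distribution `μ`. -/
structure IsIIDSample {A Ω : Type*} [MeasurableSpace Ω] (P : Measure Ω) (μ : A → ℝ)
    (ξ : ℕ → Ω → A) : Prop where
  measurableSet_eq : ∀ i a, MeasurableSet {ω | ξ i ω = a}
  law : ∀ i a, P.real {ω | ξ i ω = a} = μ a
  indep : iIndepFun (m := fun _ => ⊤) ξ P

/-- Observed frequencies in a sample of size `N`. -/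
def sampleFreq {A Ω : Type*} [DecidableEq A] (ξ : ℕ → Ω → A) (N : ℕ) (ω : Ω) (a : A) : ℝ :=
  (((Finset.range N).filter fun i => ξ i ω = a).card : ℝ) / N

/-- `V` is the asymptotic variance-covariance matrix of the estimator sequence `T` of `θ`:
`√N (T_N - θ)` converges in distribution to the centered Gaussian law with covariance `V`. -/
def HasAsymptoticVariance {Ω ι : Type*} [MeasurableSpace Ω] [Fintype ι] [DecidableEq ι]
    (P : Measure Ω) [IsProbabilityMeasure P] (T : ℕ → Ω → ι → ℝ) (θ : ι → ℝ)
    (V : Matrix ι ι ℝ) : Prop :=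
  V.PosSemidef ∧
    TendstoInDistribution
      (fun (N : ℕ) ω => WithLp.toLp 2 (Real.sqrt N • (T N ω - θ))) atTop
      (id : EuclideanSpace ℝ ι → EuclideanSpace ℝ ι) (fun _ => P) (multivariateGaussian 0 V)

end

/-! ### Logit choice probabilities -/

/-! The regression objective is concave in γ, so its maximizers are exactly the solutions of the
moment equations Zᵀ W m = F(γ), where F(γ) = Zᵀ W exp(Zγ) is `fittedMoments`
(`isMaxOn_weightedPoissonObjective_iff`). Since Z is injective, F is strictly monotone, hence
injective, and its Jacobian A(γ) is invertible. For positive m the objective is also coercive, so a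
solution exists.

By the inverse function theorem, near μ the estimator is F⁻¹(Zᵀ W m), with derivative A⁻¹ Zᵀ W at μ
(`hasFDerivWithinAt_poissonRegression`). Observed frequencies are means of i.i.d. basis vectors, so
√N(μ̂ - μ) has a Gaussian limit with covariance diag(μ) - μμᵀ. The delta method carries this limit
through the derivative, and the resulting covariance is A⁻¹ B A⁻¹ at the population values. The
sandwich is continuous in (γ, m), so the law of large numbers gives its consistency.

In the Choo and Siow model, logit choice on the two sides of the market gives μ_xy² = μ_x0 μ_0y
exp(Φ_xy). Hence log μ = Zγ for a γ containing the true β. The moment equations then hold with zero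
residual, and uniqueness identifies γ with γ₀. -/

lemma hasDerivAt_exp_neg_mul_exp_neg_div {S : ℝ} (hS : 0 < S) (t : ℝ) :
    HasDerivAt (fun t => Real.exp (-(S * Real.exp (-t))) / S)
      (Real.exp (-t) * Real.exp (-(S * Real.exp (-t)))) t := by
  have h1 : HasDerivAt (fun t : ℝ => Real.exp (-t)) (-Real.exp (-t)) t := by
    simpa using (hasDerivAt_neg t).exp
  convert! ((h1.const_mul S).fun_neg.exp.div_const S) using 1
  field_simp

lemma tendsto_exp_neg_mul_exp_neg_div_atTop (S : ℝ) :
    Tendsto (fun t => Real.exp (-(S * Real.exp (-t))) / S) atTop (𝓝 (1 / S)) := by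
  have h : Tendsto (fun t : ℝ => Real.exp (-t)) atTop (𝓝 0) :=
    Real.tendsto_exp_atBot.comp tendsto_neg_atTop_atBot
  have := ((Real.continuous_exp.tendsto _).comp (h.const_mul S).neg).div_const S
  simpa [Function.comp_def] using this

lemma tendsto_exp_neg_mul_exp_neg_div_atBot {S : ℝ} (hS : 0 < S) :
    Tendsto (fun t => Real.exp (-(S * Real.exp (-t))) / S) atBot (𝓝 0) := by
  have h : Tendsto (fun t : ℝ => Real.exp (-t)) atBot atTop :=
    Real.tendsto_exp_atTop.comp tendsto_neg_atBot_atTop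
  have := (Real.tendsto_exp_atBot.comp
    (tendsto_neg_atTop_atBot.comp (h.const_mul_atTop hS))).div_const S
  simpa [Function.comp_def] using this

/-- The explicit antiderivative stays between 0 and 1/S, which bounds the integrals over all [-n,
n]. General S is needed because multiplying the Gumbel density by rivals' distribution functions
replaces S = 1 by a sum of exponentials. -/
lemma integrable_exp_neg_mul_exp_neg_mul {S : ℝ} (hS : 0 < S) :
    Integrable fun t : ℝ => Real.exp (-t) * Real.exp (-(S * Real.exp (-t))) := by
  have hcont : Continuous fun t : ℝ => Real.exp (-t) * Real.exp (-(S * Real.exp (-t))) := by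
    fun_prop
  refine integrable_of_intervalIntegral_norm_bounded (a := fun n : ℕ => -(n : ℝ))
    (b := fun n : ℕ => (n : ℝ)) (l := atTop) (1 / S) (fun i => ?_)
    (tendsto_neg_atTop_atBot.comp tendsto_natCast_atTop_atTop) tendsto_natCast_atTop_atTop
    (Eventually.of_forall fun i => ?_)
  · exact (hcont.integrableOn_Icc).mono_set Set.Ioc_subset_Icc_self
  · have : (fun t : ℝ => ‖Real.exp (-t) * Real.exp (-(S * Real.exp (-t)))‖) =
        fun t => Real.exp (-t) * Real.exp (-(S * Real.exp (-t))) := by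
      funext t; rw [Real.norm_of_nonneg (by positivity)]
    rw [this, intervalIntegral.integral_eq_sub_of_hasDerivAt
      (fun t _ => hasDerivAt_exp_neg_mul_exp_neg_div hS t) (hcont.intervalIntegrable _ _)]
    have h1 : Real.exp (-(S * Real.exp (-(i : ℝ)))) ≤ 1 :=
      Real.exp_le_one_iff.2 (by have := Real.exp_pos (-(i : ℝ)); nlinarith)
    have h2 : 0 ≤ Real.exp (-(S * Real.exp (-(-(i : ℝ))))) / S := by positivity
    have h3 : Real.exp (-(S * Real.exp (-(i : ℝ)))) / S ≤ 1 / S := by gcongr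
    linarith

lemma lintegral_exp_neg_mul_exp_neg_mul {S : ℝ} (hS : 0 < S) :
    ∫⁻ t : ℝ, ENNReal.ofReal (Real.exp (-t) * Real.exp (-(S * Real.exp (-t)))) =
      ENNReal.ofReal (1 / S) := by
  rw [← ofReal_integral_eq_lintegral_ofReal (integrable_exp_neg_mul_exp_neg_mul hS)
    (Eventually.of_forall fun t => by positivity),
    integral_of_hasDerivAt_of_tendsto (hasDerivAt_exp_neg_mul_exp_neg_div hS)
      (integrable_exp_neg_mul_exp_neg_mul hS) (tendsto_exp_neg_mul_exp_neg_div_atBot hS)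
      (tendsto_exp_neg_mul_exp_neg_div_atTop S), sub_zero]

lemma gumbel_eq_withDensity :
    gumbel = volume.withDensity fun t =>
      ENNReal.ofReal (Real.exp (-t) * Real.exp (-(1 * Real.exp (-t)))) := by
  simp only [gumbel, one_mul, ← Real.exp_add, sub_eq_add_neg]

instance isProbabilityMeasure_gumbel : IsProbabilityMeasure gumbel := by
  constructor
  rw [gumbel_eq_withDensity, withDensity_apply _ MeasurableSet.univ, Measure.restrict_univ,
    lintegral_exp_neg_mul_exp_neg_mul one_pos]
  simp

lemma gumbel_Iic (s : ℝ) : gumbel (Set.Iic s) = ENNReal.ofReal (Real.exp (-Real.exp (-s))) := by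
  rw [gumbel_eq_withDensity, withDensity_apply _ measurableSet_Iic,
    ← ofReal_integral_eq_lintegral_ofReal (integrable_exp_neg_mul_exp_neg_mul one_pos).integrableOn
    (Eventually.of_forall fun t => by positivity),
    integral_Iic_of_hasDerivAt_of_tendsto'
      (fun t _ => hasDerivAt_exp_neg_mul_exp_neg_div one_pos t)
      (integrable_exp_neg_mul_exp_neg_mul one_pos).integrableOn
      (tendsto_exp_neg_mul_exp_neg_div_atBot one_pos)]
  simp

/-- The probability that option `j` maximizes `v k + ε k` when the `ε k` are i.i.d. standard
Gumbel. -/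
lemma pi_gumbel_argmax {J : Type*} [Fintype J] (v : J → ℝ) (j : J) :
    (Measure.pi fun _ : J => gumbel) {ε | ∀ k, v k + ε k ≤ v j + ε j} =
      ENNReal.ofReal (Real.exp (v j) / ∑ k, Real.exp (v k)) := by
  classical
  have hmeas : MeasurableSet {ε : J → ℝ | ∀ k, v k + ε k ≤ v j + ε j} := by
    rw [Set.ofPred_forall]
    exact MeasurableSet.iInter fun k => measurableSet_le (by fun_prop) (by fun_prop)
  -- Fubini: once the shock of `j` is fixed, the event is a box in the other shocks, so its
  -- probability is a product of Gumbel distribution functions.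
  have hmp := (measurePreserving_piEquivPiSubtypeProd (fun _ : J => gumbel) (· = j)).symm
  rw [← hmp.measure_preimage hmeas.nullMeasurableSet,
    Measure.prod_apply (hmp.measurable hmeas)]
  have hslice : ∀ x : ({k // k = j} → ℝ),
      (Measure.pi fun _ : {k // ¬ k = j} => gumbel) (Prod.mk x ⁻¹'
        ((MeasurableEquiv.piEquivPiSubtypeProd (fun _ : J => ℝ) (· = j)).symm ⁻¹'
          {ε : J → ℝ | ∀ k, v k + ε k ≤ v j + ε j})) =
      ENNReal.ofReal (∏ k : {k // ¬ k = j},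
        Real.exp (-Real.exp (-(v j + x ⟨j, rfl⟩ - v k)))) := by
    intro x
    have : (Prod.mk x ⁻¹'
        ((MeasurableEquiv.piEquivPiSubtypeProd (fun _ : J => ℝ) (· = j)).symm ⁻¹'
          {ε : J → ℝ | ∀ k, v k + ε k ≤ v j + ε j})) =
        Set.univ.pi fun k : {k // ¬ k = j} => Set.Iic (v j + x ⟨j, rfl⟩ - v k) := by
      ext z
      simp only [MeasurableEquiv.piEquivPiSubtypeProd, MeasurableEquiv.symm_mk,
        MeasurableEquiv.coe_mk, Set.mem_preimage, Set.mem_ofPred_eq,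
        Equiv.piEquivPiSubtypeProd_symm_apply, dite_true, Set.mem_univ_pi, Set.mem_Iic]
      constructor
      · intro h k
        have := h k
        rw [dif_neg k.2] at this
        simp only [Subtype.coe_eta] at this
        linarith
      · intro h k
        by_cases hk : k = j
        · subst hk; simp
        · rw [dif_neg hk]
          have := h ⟨k, hk⟩
          simp only at this
          linarith
    rw [this, Measure.pi_pi, ENNReal.ofReal_prod_of_nonneg fun _ _ => (Real.exp_pos _).le]
    exact Finset.prod_congr rfl fun k _ => gumbel_Iic _
  simp_rw [hslice]
  have huniq := measurePreserving_piUnique (fun _ : {k // k = j} => gumbel)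
  have hS : 0 < ∑ k, Real.exp (v k - v j) :=
    Finset.sum_pos (fun _ _ => Real.exp_pos _) ⟨j, Finset.mem_univ _⟩
  calc _ = ∫⁻ t, ENNReal.ofReal (∏ k : {k // ¬ k = j},
        Real.exp (-Real.exp (-(v j + t - v k)))) ∂gumbel := by
        refine Eq.trans ?_ (huniq.lintegral_comp_emb (MeasurableEquiv.measurableEmbedding _)
          fun t => ENNReal.ofReal (∏ k : {k // ¬ k = j},
            Real.exp (-Real.exp (-(v j + t - v k)))))
        congr!
    _ = ∫⁻ t, ENNReal.ofReal (Real.exp (-t) *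
          Real.exp (-((∑ k, Real.exp (v k - v j)) * Real.exp (-t)))) := by
        rw [gumbel, lintegral_withDensity_eq_lintegral_mul _ (by fun_prop) (by fun_prop)]
        refine lintegral_congr fun t => ?_
        rw [Pi.mul_apply, ← ENNReal.ofReal_mul (Real.exp_pos _).le]
        congr 1
        rw [← Real.exp_sum, ← Real.exp_add, ← Real.exp_add]
        congr 1
        -- The term `k = j` equals 1 and accounts for the double exponential in the density of the
        -- shock of `j` itself.
        have h1 : ∑ k, Real.exp (v k - v j) =
            1 + ∑ k : {k // ¬ k = j}, Real.exp (v k - v j) := by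
          rw [← Finset.add_sum_erase _ _ (Finset.mem_univ j), sub_self, Real.exp_zero]
          congr 1
          exact (Finset.sum_subtype _ (by simp) _)
        rw [h1, Finset.sum_neg_distrib, add_mul, Finset.sum_mul]
        have h2 : ∀ k : {k // ¬ k = j},
            Real.exp (-(v j + t - v k)) = Real.exp (v k - v j) * Real.exp (-t) := by
          intro k; rw [← Real.exp_add]; congr 1; ring
        simp_rw [h2]
        ring
    _ = _ := by
        rw [lintegral_exp_neg_mul_exp_neg_mul hS]
        congr 1
        simp_rw [Real.exp_sub, ← Finset.sum_div]
        rw [one_div_div]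

lemma choiceProb_eq {ι : Type*} [Fintype ι] (U : ι → ℝ) (o : Option ι) :
    choiceProb U o = Real.exp (o.elim 0 U) / (1 + ∑ i, Real.exp (U i)) := by
  rw [choiceProb, measureReal_def, pi_gumbel_argmax (fun o : Option ι => o.elim 0 U) o,
    ENNReal.toReal_ofReal (by positivity), Fintype.sum_option]
  simp

lemma choiceProb_some_eq_exp_mul {ι : Type*} [Fintype ι] (U : ι → ℝ) (i : ι) :
    choiceProb U (some i) = Real.exp (U i) * choiceProb U none := by
  rw [choiceProb_eq, choiceProb_eq]
  simp [div_eq_mul_inv]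

/-- The Choo and Siow matching function. -/
lemma IsChooSiowStable.sq_eq {X Y : Type*} [Fintype X] [Fintype Y] {Φ : X × Y → ℝ}
    {μ : Arrangement X Y → ℝ} (h : IsChooSiowStable Φ μ) (x : X) (y : Y) :
    μ (.inl (x, y)) ^ 2 =
      μ (.inr (.inl x)) * μ (.inr (.inr y)) * Real.exp (Φ (x, y)) := by
  obtain ⟨U, V, hUV, h1, h2, h3, h4⟩ := h
  -- Each side's odds against singlehood express the same number of couples; in the product of the
  -- two expressions, U and V enter only through their sum Φ.
  have hm : μ (.inl (x, y)) = Real.exp (U x y) * μ (.inr (.inl x)) := by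
    rw [h1, h2, choiceProb_some_eq_exp_mul]; ring
  have hw : μ (.inl (x, y)) = Real.exp (V x y) * μ (.inr (.inr y)) := by
    rw [h3, h4, choiceProb_some_eq_exp_mul]; ring
  rw [sq, ← hUV, Real.exp_add]
  nth_rw 1 [hm]
  rw [hw]
  ring

/-! ### Weighted Poisson regression -/

section PoissonRegression

open Matrix

variable {A ι : Type*} [Fintype A] [Fintype ι]

/-- The weighted Poisson pseudo-likelihood for weights `w` and design matrix `Z`. -/
noncomputable def weightedPoissonObjective (Z : Matrix A ι ℝ) (w m : A → ℝ) (γ : ι → ℝ) : ℝ :=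
  ∑ a, w a * m a * (Z *ᵥ γ) a - ∑ a, w a * Real.exp ((Z *ᵥ γ) a)

/-- The weighted sums of regressors `Zᵀ W exp(Z γ)` fitted by the parameter `γ`. -/
noncomputable def fittedMoments (Z : Matrix A ι ℝ) (w : A → ℝ) (γ : ι → ℝ) : ι → ℝ :=
  Zᵀ *ᵥ fun a => w a * Real.exp ((Z *ᵥ γ) a)

/-- The matrix `Zᵀ W diag(exp(Z γ)) Z`. -/
noncomputable def poissonInformation [DecidableEq A] (Z : Matrix A ι ℝ) (w : A → ℝ) (γ : ι → ℝ) :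
    Matrix ι ι ℝ :=
  Zᵀ * diagonal w * diagonal (fun a => Real.exp ((Z *ᵥ γ) a)) * Z

variable {Z : Matrix A ι ℝ} {w m : A → ℝ} {γ γ' : ι → ℝ}

/-- Concavity makes the moment equations sufficient: the first-order term vanishes because the
weighted residual is orthogonal to the range of Z, and the remainder is nonpositive because exp lies
above its tangents. -/
lemma weightedPoissonObjective_sub_le (hw : ∀ a, 0 < w a)
    (h : Zᵀ *ᵥ (fun a => w a * m a) = fittedMoments Z w γ) :
    weightedPoissonObjective Z w m γ' ≤ weightedPoissonObjective Z w m γ := by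
  have h0 : ∑ a, w a * (m a - Real.exp ((Z *ᵥ γ) a)) * ((Z *ᵥ γ') a - (Z *ᵥ γ) a) = 0 := by
    have h1 : Zᵀ *ᵥ (fun a => w a * (m a - Real.exp ((Z *ᵥ γ) a))) = 0 := by
      rw [← sub_eq_zero.2 h, fittedMoments, ← mulVec_sub]
      congr 1
      funext a
      simp [mul_sub]
    have h2 : (fun a => w a * (m a - Real.exp ((Z *ᵥ γ) a))) ⬝ᵥ (Z *ᵥ (γ' - γ)) = 0 := by
      rw [dotProduct_mulVec, ← mulVec_transpose, h1, zero_dotProduct]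
    simpa [dotProduct, mulVec_sub] using h2
  have h3 : weightedPoissonObjective Z w m γ' - weightedPoissonObjective Z w m γ =
      ∑ a, w a * (m a - Real.exp ((Z *ᵥ γ) a)) * ((Z *ᵥ γ') a - (Z *ᵥ γ) a) +
      ∑ a, w a * (Real.exp ((Z *ᵥ γ) a) + Real.exp ((Z *ᵥ γ) a) * ((Z *ᵥ γ') a - (Z *ᵥ γ) a) -
        Real.exp ((Z *ᵥ γ') a)) := by
    simp only [weightedPoissonObjective, ← Finset.sum_sub_distrib, ← Finset.sum_add_distrib]
    exact Finset.sum_congr rfl fun a _ => by ring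
  have h4 : ∑ a, w a * (Real.exp ((Z *ᵥ γ) a) +
      Real.exp ((Z *ᵥ γ) a) * ((Z *ᵥ γ') a - (Z *ᵥ γ) a) - Real.exp ((Z *ᵥ γ') a)) ≤ 0 := by
    refine Finset.sum_nonpos fun a _ => mul_nonpos_of_nonneg_of_nonpos (hw a).le ?_
    have h5 := Real.add_one_le_exp ((Z *ᵥ γ') a - (Z *ᵥ γ) a)
    have h6 : Real.exp ((Z *ᵥ γ') a) =
        Real.exp ((Z *ᵥ γ) a) * Real.exp ((Z *ᵥ γ') a - (Z *ᵥ γ) a) := by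
      rw [← Real.exp_add]; congr 1; ring
    rw [h6]
    nlinarith [Real.exp_pos ((Z *ᵥ γ) a)]
  linarith

/-- A parameter maximizes the pseudo-likelihood iff it fits the observed moments. -/
lemma isMaxOn_weightedPoissonObjective_iff (hw : ∀ a, 0 < w a) :
    IsMaxOn (weightedPoissonObjective Z w m) Set.univ γ ↔
      Zᵀ *ᵥ (fun a => w a * m a) = fittedMoments Z w γ := by
  refine ⟨fun h => ?_, fun h γ' _ => weightedPoissonObjective_sub_le hw h⟩
  classical
  funext i
  -- Necessity is Fermat's rule along each coordinate direction.
  let line : ℝ → ℝ := fun t => weightedPoissonObjective Z w m (γ + t • Pi.single i 1)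
  have hmax : IsLocalMax line 0 := by
    refine Eventually.of_forall fun t => ?_
    simpa [line] using h (Set.mem_univ _)
  have hZ : ∀ t a, (Z *ᵥ (γ + t • Pi.single i 1)) a = (Z *ᵥ γ) a + t * Z a i := by
    intro t a
    rw [mulVec_add, mulVec_smul, mulVec_single_one]
    simp
  have hlin : ∀ a, HasDerivAt (fun t => (Z *ᵥ γ) a + t * Z a i) (Z a i) (0 : ℝ) := fun a => by
    simpa using ((hasDerivAt_id (0 : ℝ)).mul_const (Z a i)).const_add ((Z *ᵥ γ) a)
  have hder : HasDerivAt line (∑ a, w a * m a * Z a i -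
      ∑ a, w a * (Real.exp ((Z *ᵥ γ) a) * Z a i)) 0 := by
    simp only [line, weightedPoissonObjective, hZ]
    refine (HasDerivAt.fun_sum fun a _ => (hlin a).const_mul _).sub
      (HasDerivAt.fun_sum fun a _ => ?_)
    simpa using (hlin a).exp.const_mul (w a)
  have := hmax.hasDerivAt_eq_zero hder
  simp only [fittedMoments, mulVec, dotProduct, transpose_apply] at this ⊢
  rw [← sub_eq_zero, ← this]
  congr 1 <;> exact Finset.sum_congr rfl fun a _ => by ring

/-- Pairing the difference of moments with γ - γ' gives a weighted sum of terms (eˢ - eᵗ)(s - t).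
Each is nonnegative and vanishes only for s = t, so equal moments force Zγ = Zγ'. -/
lemma fittedMoments_injective (hw : ∀ a, 0 < w a) (hZ : Function.Injective Z.mulVec) :
    Function.Injective (fittedMoments Z w) := by
  intro γ γ' h
  have h1 : ∑ a, w a * ((Real.exp ((Z *ᵥ γ) a) - Real.exp ((Z *ᵥ γ') a)) *
      ((Z *ᵥ γ) a - (Z *ᵥ γ') a)) = 0 := by
    have h2 : (fun a => w a * Real.exp ((Z *ᵥ γ) a) - w a * Real.exp ((Z *ᵥ γ') a)) ⬝ᵥ
        (Z *ᵥ (γ - γ')) = 0 := by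
      rw [dotProduct_mulVec, ← mulVec_transpose]
      have : Zᵀ *ᵥ (fun a => w a * Real.exp ((Z *ᵥ γ) a) - w a * Real.exp ((Z *ᵥ γ') a)) =
          fittedMoments Z w γ - fittedMoments Z w γ' := by
        simp only [fittedMoments, ← mulVec_sub]; rfl
      rw [this, h, sub_self, zero_dotProduct]
    rw [← h2, mulVec_sub]
    exact Finset.sum_congr rfl fun a _ => by simp only [Pi.sub_apply]; ring
  have hnn : ∀ s t : ℝ, 0 ≤ (Real.exp s - Real.exp t) * (s - t) := fun s t => by
    rcases le_total s t with hst | hst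
    · exact mul_nonneg_of_nonpos_of_nonpos (sub_nonpos.2 (Real.exp_le_exp.2 hst))
        (sub_nonpos.2 hst)
    · exact mul_nonneg (sub_nonneg.2 (Real.exp_le_exp.2 hst)) (sub_nonneg.2 hst)
  rw [Finset.sum_eq_zero_iff_of_nonneg fun a _ => mul_nonneg (hw a).le (hnn _ _)] at h1
  refine hZ (funext fun a => ?_)
  rcases mul_eq_zero.1 (h1 a (Finset.mem_univ a)) with h3 | h3
  · exact absurd h3 (hw a).ne'
  · rcases mul_eq_zero.1 h3 with h4 | h4
    · exact Real.exp_injective (sub_eq_zero.1 h4)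
    · exact sub_eq_zero.1 h4

lemma exists_mul_sub_exp_le {p : ℝ} (hp : 0 < p) : ∃ C, ∀ s, p * s - Real.exp s ≤ C - p * |s| := by
  -- The maximum of 2ps - eˢ, attained at s = log(2p), handles s ≥ 0; the absolute value makes the
  -- constant nonnegative, which suffices for s ≤ 0.
  refine ⟨|2 * p * (Real.log (2 * p) - 1)|, fun s => ?_⟩
  rcases le_total s 0 with hs | hs
  · rw [abs_of_nonpos hs]
    have := Real.exp_pos s
    have := abs_nonneg (2 * p * (Real.log (2 * p) - 1))
    linarith
  · rw [abs_of_nonneg hs]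
    have h1 := Real.add_one_le_exp (s - Real.log (2 * p))
    have h2 : Real.exp s = 2 * p * Real.exp (s - Real.log (2 * p)) := by
      rw [Real.exp_sub, Real.exp_log (by positivity)]; field_simp
    have h3 := le_abs_self (2 * p * (Real.log (2 * p) - 1))
    nlinarith

/-- Positive data in every cell make the objective tend to -∞ as |Zγ| grows, and injectivity of Z
makes |Zγ| grow with |γ|. A continuous function with this property attains its maximum. -/
lemma exists_isMaxOn_weightedPoissonObjective (hw : ∀ a, 0 < w a) (hm : ∀ a, 0 < m a)
    (hZ : Function.Injective Z.mulVec) :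
    ∃ γ, IsMaxOn (weightedPoissonObjective Z w m) Set.univ γ := by
  have hcont : Continuous (weightedPoissonObjective Z w m) := by
    have h1 : ∀ a, Continuous fun γ => (Z *ᵥ γ) a := fun a =>
      (continuous_apply a).comp (Continuous.matrix_mulVec continuous_const continuous_id)
    unfold weightedPoissonObjective
    fun_prop
  choose C hC using fun a => exists_mul_sub_exp_le (hm a)
  have hbound : ∀ γ, weightedPoissonObjective Z w m γ ≤
      ∑ a, w a * C a - ∑ a, w a * m a * |(Z *ᵥ γ) a| := fun γ => by
    simp only [weightedPoissonObjective, ← Finset.sum_sub_distrib]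
    refine Finset.sum_le_sum fun a _ => ?_
    have := mul_le_mul_of_nonneg_left (hC a ((Z *ᵥ γ) a)) (hw a).le
    linarith
  have hZlim : Tendsto Z.mulVec (cocompact (ι → ℝ)) (cocompact (A → ℝ)) :=
    (LinearMap.isClosedEmbedding_of_injective (f := Z.mulVecLin)
      (LinearMap.ker_eq_bot.2 hZ)).tendsto_cocompact
  have hlim : Tendsto (fun s : A → ℝ => ∑ a, w a * m a * |s a|) (cocompact (A → ℝ)) atTop := by
    rcases isEmpty_or_nonempty A with hA | hA
    · have : cocompact (A → ℝ) = ⊥ := cocompact_eq_bot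
      rw [this]; exact tendsto_bot
    · obtain ⟨b, hb⟩ := Finite.exists_min fun a => w a * m a
      refine tendsto_atTop_mono (fun s => ?_)
        ((tendsto_norm_cocompact_atTop (E := A → ℝ)).const_mul_atTop (mul_pos (hw b) (hm b)))
      have hnorm : ‖s‖ ≤ ∑ a, |s a| :=
        (pi_norm_le_iff_of_nonneg (Finset.sum_nonneg fun _ _ => abs_nonneg _)).2 fun a =>
          Finset.single_le_sum (f := fun a => |s a|) (fun _ _ => abs_nonneg _) (Finset.mem_univ a)
      calc w b * m b * ‖s‖ ≤ w b * m b * ∑ a, |s a| :=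
            mul_le_mul_of_nonneg_left hnorm (mul_pos (hw b) (hm b)).le
        _ ≤ _ := by
            rw [Finset.mul_sum]
            exact Finset.sum_le_sum fun a _ => mul_le_mul_of_nonneg_right (hb a) (abs_nonneg _)
  obtain ⟨γ, hγ⟩ := hcont.exists_forall_ge <|
    tendsto_atBot_mono hbound <| tendsto_atBot_add_const_left _ (∑ a, w a * C a) <|
      tendsto_neg_atTop_atBot.comp (hlim.comp hZlim)
  exact ⟨γ, fun γ' _ => hγ γ'⟩

variable [DecidableEq A]

lemma poissonInformation_mulVec (v : ι → ℝ) :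
    poissonInformation Z w γ *ᵥ v =
      Zᵀ *ᵥ fun a => w a * (Real.exp ((Z *ᵥ γ) a) * (Z *ᵥ v) a) := by
  simp only [poissonInformation, ← mulVec_mulVec]
  congr 1
  funext a
  simp only [mulVec_diagonal]

lemma poissonInformation_transpose : (poissonInformation Z w γ)ᵀ = poissonInformation Z w γ := by
  simp only [poissonInformation, transpose_mul, diagonal_transpose, transpose_transpose,
    Matrix.mul_assoc]
  congr 1
  rw [← Matrix.mul_assoc, ← Matrix.mul_assoc, diagonal_mul_diagonal, diagonal_mul_diagonal]
  simp_rw [mul_comm]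

/-- The quadratic form of this matrix at v is the sum of w exp(Zγ) (Zv)², which vanishes only if Zv
= 0. -/
lemma isUnit_det_poissonInformation [DecidableEq ι] (hw : ∀ a, 0 < w a)
    (hZ : Function.Injective Z.mulVec) (γ : ι → ℝ) :
    IsUnit (poissonInformation Z w γ).det := by
  rw [← isUnit_iff_isUnit_det, ← mulVec_injective_iff_isUnit]
  refine (injective_iff_map_eq_zero (poissonInformation Z w γ).mulVecLin).2 fun v hv => ?_
  rw [mulVecLin_apply, poissonInformation_mulVec] at hv
  have h1 : ∑ a, w a * (Real.exp ((Z *ᵥ γ) a) * (Z *ᵥ v) a) * (Z *ᵥ v) a = 0 := by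
    have : (fun a => w a * (Real.exp ((Z *ᵥ γ) a) * (Z *ᵥ v) a)) ⬝ᵥ (Z *ᵥ v) = 0 := by
      rw [dotProduct_mulVec, ← mulVec_transpose, hv, zero_dotProduct]
    exact this
  have h2 : ∀ a, w a * (Real.exp ((Z *ᵥ γ) a) * (Z *ᵥ v) a) * (Z *ᵥ v) a =
      w a * Real.exp ((Z *ᵥ γ) a) * (Z *ᵥ v) a ^ 2 := fun a => by ring
  simp_rw [h2] at h1
  have hpos : ∀ a, 0 < w a * Real.exp ((Z *ᵥ γ) a) := fun a => mul_pos (hw a) (Real.exp_pos _)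
  rw [Finset.sum_eq_zero_iff_of_nonneg fun a _ => mul_nonneg (hpos a).le (sq_nonneg _)] at h1
  refine hZ ?_
  rw [mulVec_zero]
  funext a
  have := h1 a (Finset.mem_univ a)
  simpa [(hw a).ne'] using this

/-- A matrix as a continuous linear map. -/
noncomputable def matrixCLM {B C : Type*} [Fintype C] (M : Matrix B C ℝ) :
    (C → ℝ) →L[ℝ] (B → ℝ) where
  toLinearMap := M.mulVecLin
  cont := Continuous.matrix_mulVec continuous_const continuous_id

@[simp]
lemma matrixCLM_apply {B C : Type*} [Fintype C] (M : Matrix B C ℝ) (v : C → ℝ) :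
    matrixCLM M v = M *ᵥ v := rfl

/-- Strict differentiability is what the inverse function theorem requires. -/
lemma hasStrictFDerivAt_fittedMoments (γ : ι → ℝ) :
    HasStrictFDerivAt (fittedMoments Z w) (matrixCLM (poissonInformation Z w γ)) γ := by
  have h1 : HasStrictFDerivAt (fun γ => fun a => w a * Real.exp ((Z *ᵥ γ) a))
      (ContinuousLinearMap.pi fun a => w a • Real.exp ((Z *ᵥ γ) a) •
        ((ContinuousLinearMap.proj a).comp (matrixCLM Z) : (ι → ℝ) →L[ℝ] ℝ)) γ :=
    hasStrictFDerivAt_pi.2 fun a =>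
      (((ContinuousLinearMap.proj a).comp (matrixCLM Z) :
        (ι → ℝ) →L[ℝ] ℝ).hasStrictFDerivAt.exp.const_mul (w a))
  refine ((matrixCLM Zᵀ).hasStrictFDerivAt.comp γ h1).congr_fderiv ?_
  refine ContinuousLinearMap.ext fun v => ?_
  rw [matrixCLM_apply, poissonInformation_mulVec]
  rfl

/-- The Poisson regression, as a function of the data `m` in a set `s`, is differentiable at every
positive vector `μ`. -/
lemma hasFDerivWithinAt_poissonRegression [DecidableEq ι] {μ : A → ℝ} {s : Set (A → ℝ)}
    {g : (A → ℝ) → ι → ℝ} (hw : ∀ a, 0 < w a) (hZ : Function.Injective Z.mulVec)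
    (hμ : ∀ a, 0 < μ a) (hμs : μ ∈ s)
    (hg : ∀ m ∈ s, (∃ γ, IsMaxOn (weightedPoissonObjective Z w m) Set.univ γ) →
      IsMaxOn (weightedPoissonObjective Z w m) Set.univ (g m)) :
    HasFDerivWithinAt g
      (matrixCLM ((poissonInformation Z w (g μ))⁻¹ * Zᵀ * diagonal w)) s μ := by
  have hdet := isUnit_det_poissonInformation hw hZ (g μ)
  let e : (ι → ℝ) ≃L[ℝ] (ι → ℝ) := ContinuousLinearEquiv.equivOfInverse
    (matrixCLM (poissonInformation Z w (g μ))) (matrixCLM (poissonInformation Z w (g μ))⁻¹)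
    (fun v => by simp [nonsing_inv_mul _ hdet]) (fun v => by simp [mul_nonsing_inv _ hdet])
  have hstrict : HasStrictFDerivAt (fittedMoments Z w) (e : (ι → ℝ) →L[ℝ] (ι → ℝ)) (g μ) :=
    hasStrictFDerivAt_fittedMoments (g μ)
  have hsol : ∀ m ∈ s, (∀ a, 0 < m a) →
      matrixCLM (Zᵀ * diagonal w) m = fittedMoments Z w (g m) := fun m hm hpos => by
    rw [← (isMaxOn_weightedPoissonObjective_iff hw).1
      (hg m hm (exists_isMaxOn_weightedPoissonObjective hw hpos hZ)), matrixCLM_apply,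
      ← mulVec_mulVec]
    congr 1
    funext a
    simp [mulVec_diagonal]
  have hloc := hstrict.to_localInverse.hasFDerivAt
  rw [← hsol μ hμs hμ] at hloc
  have hcomp := (hloc.comp μ (matrixCLM (Zᵀ * diagonal w)).hasFDerivAt).hasFDerivWithinAt (s := s)
  have hright := hstrict.eventually_right_inverse
  rw [← hsol μ hμs hμ] at hright
  have hright' := (matrixCLM (Zᵀ * diagonal w)).continuous.continuousAt.eventually hright
  have hpos : ∀ᶠ m in 𝓝 μ, ∀ a, 0 < m a := eventually_all.2 fun a =>
    (continuous_apply a).continuousAt.eventually (lt_mem_nhds (hμ a))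
  -- Both sides solve the same moment equations. Global injectivity of the fitted moments identifies
  -- them, so no prior continuity of `g` is needed.
  have heq : g =ᶠ[𝓝[s] μ]
      hstrict.localInverse (fittedMoments Z w) e (g μ) ∘ matrixCLM (Zᵀ * diagonal w) := by
    filter_upwards [self_mem_nhdsWithin, mem_nhdsWithin_of_mem_nhds hright',
      mem_nhdsWithin_of_mem_nhds hpos] with m hms hr hp
    exact fittedMoments_injective hw hZ ((hsol m hms hp).symm.trans hr.symm)
  refine (hcomp.congr_of_eventuallyEq heq (heq.self_of_nhdsWithin hμs)).congr_fderiv ?_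
  refine ContinuousLinearMap.ext fun v => ?_
  change (poissonInformation Z w (g μ))⁻¹ *ᵥ ((Zᵀ * diagonal w) *ᵥ v) = _
  rw [mulVec_mulVec, matrixCLM_apply, Matrix.mul_assoc]

end PoissonRegression

/-! ### Multivariate central limit theorem and delta method -/

section Asymptotics

open Matrix

variable {Ω : Type*} [MeasurableSpace Ω] {P : Measure Ω}

/-- The image of a centered Gaussian vector under a linear map. -/
lemma multivariateGaussian_map_mulVec {A ι : Type*} [Fintype A] [Fintype ι] [DecidableEq A]
    [DecidableEq ι] {S : Matrix A A ℝ} (hS : S.PosSemidef) (M : Matrix ι A ℝ) :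
    (multivariateGaussian 0 S).map (fun x => WithLp.toLp 2 (M *ᵥ x.ofLp)) =
      multivariateGaussian 0 (M * S * Mᵀ) := by
  have hcont : Continuous fun x : EuclideanSpace ℝ A => WithLp.toLp 2 (M *ᵥ x.ofLp) :=
    (PiLp.continuous_toLp 2 _).comp
      (Continuous.matrix_mulVec continuous_const (PiLp.continuous_ofLp 2 _))
  have hS' : (M * S * Mᵀ).PosSemidef := by simpa using hS.mul_mul_conjTranspose_same M
  have := Measure.isProbabilityMeasure_map (μ := multivariateGaussian 0 S)
    hcont.measurable.aemeasurable
  refine Measure.ext_of_charFun (funext fun t => ?_)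
  have h1 : charFun ((multivariateGaussian 0 S).map fun x => WithLp.toLp 2 (M *ᵥ x.ofLp)) t =
      charFun (multivariateGaussian 0 S) (WithLp.toLp 2 (Mᵀ *ᵥ t.ofLp)) := by
    rw [charFun_apply, charFun_apply,
      integral_map hcont.measurable.aemeasurable (by fun_prop)]
    congr 1
    funext x
    simp only [EuclideanSpace.inner_eq_star_dotProduct, star_trivial]
    rw [dotProduct_mulVec, ← mulVec_transpose]
  rw [h1, charFun_multivariateGaussian hS, charFun_multivariateGaussian hS']
  congr 2
  · simp
  · congr 2
    rw [mulVec_transpose, ← mulVec_mulVec, ← mulVec_mulVec, ← dotProduct_mulVec, mulVec_transpose]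

/-- Cramér–Wold: the characteristic function at `t` depends only on the projection on `t`, which
reduces the vector limit theorem to the real one. -/
lemma charFun_map_inner {E : Type*} [NormedAddCommGroup E] [InnerProductSpace ℝ E]
    [MeasurableSpace E] [BorelSpace E] [SecondCountableTopology E] {V : Ω → E}
    (hV : AEMeasurable V P) (t : E) :
    charFun (P.map V) t = charFun (P.map fun ω => inner ℝ t (V ω)) 1 := by
  rw [charFun_apply, charFun_apply, integral_map hV (by fun_prop),
    integral_map (by fun_prop) (by fun_prop)]
  simp [real_inner_comm]

variable [IsProbabilityMeasure P]

/-- **Central limit theorem** for i.i.d. square integrable random vectors. -/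
theorem tendstoInDistribution_multivariateGaussian {ι : Type*} [Fintype ι] [DecidableEq ι]
    {X : ℕ → Ω → EuclideanSpace ℝ ι} {S : Matrix ι ι ℝ} (hS : S.PosSemidef)
    (hX : MemLp (X 0) 2 P) (hindep : iIndepFun X P)
    (hident : ∀ i, IdentDistrib (X i) (X 0) P P)
    (hvar : ∀ t : EuclideanSpace ℝ ι,
      Var[fun ω => inner ℝ t (X 0 ω); P] = t.ofLp ⬝ᵥ S *ᵥ t.ofLp) :
    TendstoInDistribution
      (fun (n : ℕ) ω => (√n)⁻¹ • (∑ k ∈ Finset.range n, X k ω - (n : ℝ) • P[X 0])) atTop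
      (id : EuclideanSpace ℝ ι → EuclideanSpace ℝ ι) (fun _ => P) (multivariateGaussian 0 S) where
  forall_aemeasurable n := by
    have : ∀ i, AEMeasurable (X i) P := fun i => (hident i).aemeasurable_fst
    have := Finset.aemeasurable_fun_sum (Finset.range n) fun i _ => this i
    fun_prop
  tendsto := by
    have hXm : ∀ i, AEMeasurable (X i) P := fun i => (hident i).aemeasurable_fst
    refine ProbabilityMeasure.tendsto_iff_tendsto_charFun.2 fun t => ?_
    have hclt := tendstoInDistribution_inv_sqrt_mul_sum_sub (P := P)
      (X := fun k ω => inner ℝ t (X k ω)) (Y := id)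
      (P' := gaussianReal 0 Var[fun ω => inner ℝ t (X 0 ω); P].toNNReal)
      ⟨aemeasurable_id, Measure.map_id⟩ (hX.const_inner t)
      (hindep.comp (fun _ x => inner ℝ t x) fun _ => by fun_prop)
      (fun i => (hident i).comp (u := fun x => inner ℝ t x) (by fun_prop))
    have hlim := ProbabilityMeasure.tendsto_iff_tendsto_charFun.1 hclt.tendsto 1
    simp only [ProbabilityMeasure.coe_mk, Measure.map_id, charFun_gaussianReal] at hlim ⊢
    have hint : P[fun ω => inner ℝ t (X 0 ω)] = inner ℝ t P[X 0] :=
      integral_inner (hX.integrable one_le_two) t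
    convert! hlim using 1
    · funext n
      have hm : AEMeasurable
          (fun ω => (√n)⁻¹ • (∑ k ∈ Finset.range n, X k ω - (n : ℝ) • P[X 0])) P := by
        have := Finset.aemeasurable_fun_sum (Finset.range n) fun i _ => hXm i
        fun_prop
      rw [charFun_map_inner hm]
      congr 2
      funext ω
      rw [hint, real_inner_smul_right, inner_sub_right, inner_sum, real_inner_smul_right]
    · rw [charFun_multivariateGaussian hS, ← hvar,
        Real.coe_toNNReal _ (variance_nonneg _ _)]
      simp

/-- **Delta method**: if `r N • (T N - θ)` converges in distribution to `Z` and `g` has derivative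
`D` at `θ` within a set that eventually contains `T N`, then `r N • (g (T N) - g θ)` converges in
distribution to `D Z`. -/
theorem tendstoInDistribution_comp_of_hasFDerivWithinAt {A ι Ω' : Type*} [Fintype A] [Fintype ι]
    [MeasurableSpace Ω'] {P' : Measure Ω'} [IsProbabilityMeasure P']
    {T : ℕ → Ω → A → ℝ} {θ : A → ℝ} {s : Set (A → ℝ)} {g : (A → ℝ) → ι → ℝ}
    {D : (A → ℝ) →L[ℝ] (ι → ℝ)} {r : ℕ → ℝ} {Z : Ω' → EuclideanSpace ℝ A}
    (hg : HasFDerivWithinAt g D s θ) (hr : ∀ N, 0 ≤ r N)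
    (hTs : ∀ᵐ ω ∂P, ∀ᶠ N in atTop, T N ω ∈ s)
    (hTθ : ∀ᵐ ω ∂P, Tendsto (fun N => T N ω) atTop (𝓝 θ))
    (hT : ∀ N, AEMeasurable (T N) P) (hgT : ∀ N, AEMeasurable (fun ω => g (T N ω)) P)
    (hZ : TendstoInDistribution
      (fun N ω => (WithLp.toLp 2 (r N • (T N ω - θ)) : EuclideanSpace ℝ A)) atTop Z
      (fun _ => P) P') :
    TendstoInDistribution
      (fun N ω => (WithLp.toLp 2 (r N • (g (T N ω) - g θ)) : EuclideanSpace ℝ ι)) atTop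
      (fun ω => (WithLp.toLp 2 (D (Z ω).ofLp) : EuclideanSpace ℝ ι)) (fun _ => P) P' := by
  -- The normalized Taylor remainder; it is 0 at `m = θ` because the inverse of zero is zero.
  let R : (A → ℝ) → ι → ℝ := fun m => ‖m - θ‖⁻¹ • (g m - g θ - D (m - θ))
  have hRm : ∀ N, AEMeasurable (fun ω => R (T N ω)) P := fun N =>
    ((hT N).sub_const θ).norm.inv.smul
      (((hgT N).sub_const (g θ)).sub (D.continuous.measurable.comp_aemeasurable
        ((hT N).sub_const θ)))
  have hR : TendstoInMeasure P (fun N ω => R (T N ω)) atTop fun _ => 0 := by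
    refine tendstoInMeasure_of_tendsto_ae (fun N => (hRm N).aestronglyMeasurable) ?_
    filter_upwards [hTs, hTθ] with ω h1 h2
    exact hg.isLittleO.norm_right.tendsto_inv_smul_nhds_zero.comp
      (tendsto_nhdsWithin_iff.2 ⟨h2, h1⟩)
  -- Slutsky: with u the scaled deviation, the target is exactly D u + ‖u‖ R, a continuous function
  -- of (u, R), and R tends to 0 in probability.
  let h : EuclideanSpace ℝ A × (ι → ℝ) → EuclideanSpace ℝ ι :=
    fun p => WithLp.toLp 2 (D p.1.ofLp + ‖p.1.ofLp‖ • p.2)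
  have hh : Continuous h := by
    refine (PiLp.continuous_toLp 2 _).comp ?_
    have : Continuous fun p : EuclideanSpace ℝ A × (ι → ℝ) => p.1.ofLp :=
      (PiLp.continuous_ofLp 2 _).comp continuous_fst
    fun_prop
  have hlim := hZ.continuous_comp_prodMk_of_tendstoInMeasure_const hh hR hRm
  convert! hlim using 1
  · funext N ω
    simp only [h, R]
    congr 1
    rcases eq_or_ne (T N ω) θ with h0 | h0
    · simp [h0]
    · have h1 : ‖T N ω - θ‖ ≠ 0 := norm_ne_zero_iff.2 (sub_ne_zero.2 h0)
      rw [map_smul, norm_smul, Real.norm_of_nonneg (hr N), smul_smul, mul_assoc,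
        mul_inv_cancel₀ h1, mul_one, ← smul_add, add_sub_cancel]
  · funext ω
    simp [h]

end Asymptotics

/-! ### Observed frequencies -/

lemma sum_range_ite_eq_card {A Ω : Type*} [DecidableEq A] (ξ : ℕ → Ω → A) (N : ℕ) (ω : Ω) (a : A) :
    ∑ i ∈ Finset.range N, (if ξ i ω = a then (1 : ℝ) else 0) =
      ((Finset.range N).filter fun i => ξ i ω = a).card := by
  simp

lemma sampleFreq_mem_stdSimplex {A Ω : Type*} [Fintype A] [DecidableEq A] (ξ : ℕ → Ω → A) {N : ℕ}
    (hN : N ≠ 0) (ω : Ω) :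
    sampleFreq ξ N ω ∈ stdSimplex ℝ A := by
  refine ⟨fun a => by unfold sampleFreq; positivity, ?_⟩
  simp only [sampleFreq, ← Finset.sum_div]
  rw [← Nat.cast_sum, ← Finset.card_eq_sum_card_fiberwise fun _ _ => Finset.mem_coe.2
    (Finset.mem_univ _), Finset.card_range, div_self (Nat.cast_ne_zero.2 hN)]

/-- Encoding each draw as a standard basis vector turns frequencies into sample means, the form used
by the central limit theorem. For N = 0 both sides vanish. -/
lemma sqrt_smul_sampleFreq_sub {A Ω : Type*} [Fintype A] [DecidableEq A] (μ : A → ℝ)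
    (ξ : ℕ → Ω → A) (N : ℕ) (ω : Ω) :
    (WithLp.toLp 2 (√(N : ℝ) • (sampleFreq ξ N ω - μ)) : EuclideanSpace ℝ A) =
      (√(N : ℝ))⁻¹ • (∑ k ∈ Finset.range N, EuclideanSpace.single (ξ k ω) (1 : ℝ) -
        (N : ℝ) • WithLp.toLp 2 μ) := by
  rcases eq_or_ne N 0 with rfl | hN
  · simp
  have hN' : (N : ℝ) ≠ 0 := Nat.cast_ne_zero.2 hN
  have hsq : √(N : ℝ) * √(N : ℝ) = N := Real.mul_self_sqrt (Nat.cast_nonneg N)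
  have hs : √(N : ℝ) ≠ 0 := fun h => hN' (by rw [← hsq, h, mul_zero])
  ext a
  have hsum : (∑ k ∈ Finset.range N, EuclideanSpace.single (ξ k ω) (1 : ℝ)) a =
      ((Finset.range N).filter fun i => ξ i ω = a).card := by
    rw [← sum_range_ite_eq_card]
    simp [Pi.single_apply, eq_comm]
  simp only [PiLp.smul_apply, PiLp.sub_apply, hsum, Pi.smul_apply, Pi.sub_apply, smul_eq_mul,
    sampleFreq]
  field_simp
  rw [sq, hsq]

section Sampling

open Matrix

variable {A Ω : Type*} [MeasurableSpace Ω] {P : Measure Ω} {μ : A → ℝ}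
  {ξ : ℕ → Ω → A}

namespace IsIIDSample

lemma iIndepFun_comp (hξ : IsIIDSample P μ ξ) {E : Type*} [MeasurableSpace E] (f : A → E) :
    iIndepFun (fun i ω => f (ξ i ω)) P :=
  iIndepFun.comp hξ.indep (fun _ => f) fun _ => measurable_from_top

variable [Fintype A]

lemma measurable_top (hξ : IsIIDSample P μ ξ) (i : ℕ) : Measurable[_, ⊤] (ξ i) :=
  let _ : MeasurableSpace A := ⊤
  measurable_to_countable' fun a => hξ.measurableSet_eq i a

lemma measurable_comp (hξ : IsIIDSample P μ ξ) {E : Type*} [MeasurableSpace E] (f : A → E)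
    (i : ℕ) : Measurable fun ω => f (ξ i ω) :=
  let _ : MeasurableSpace A := ⊤
  measurable_from_top.comp (hξ.measurable_top i)

lemma map_eq [IsFiniteMeasure P] (hξ : IsIIDSample P μ ξ) (i j : ℕ) :
    @Measure.map _ _ _ ⊤ (ξ i) P = @Measure.map _ _ _ ⊤ (ξ j) P := by
  let _ : MeasurableSpace A := ⊤
  refine Measure.ext_of_singleton fun a => ?_
  rw [Measure.map_apply (hξ.measurable_top i) (by trivial),
    Measure.map_apply (hξ.measurable_top j) (by trivial),
    ← ENNReal.toReal_eq_toReal_iff' (measure_ne_top _ _) (measure_ne_top _ _)]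
  exact (hξ.law i a).trans (hξ.law j a).symm

lemma identDistrib_comp [IsFiniteMeasure P] (hξ : IsIIDSample P μ ξ) {E : Type*}
    [MeasurableSpace E] (f : A → E) (i j : ℕ) :
    IdentDistrib (fun ω => f (ξ i ω)) (fun ω => f (ξ j ω)) P P :=
  let _ : MeasurableSpace A := ⊤
  IdentDistrib.comp (f := ξ i) (g := ξ j) ⟨(hξ.measurable_top i).aemeasurable,
    (hξ.measurable_top j).aemeasurable, hξ.map_eq i j⟩ measurable_from_top

lemma integral_comp [IsFiniteMeasure P] (hξ : IsIIDSample P μ ξ) {E : Type*}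
    [NormedAddCommGroup E] [NormedSpace ℝ E] [CompleteSpace E] (f : A → E) (i : ℕ) :
    ∫ ω, f (ξ i ω) ∂P = ∑ a, μ a • f a := by
  let _ : MeasurableSpace A := ⊤
  have hfin : IsFiniteMeasure (P.map (ξ i)) := inferInstance
  rw [← integral_map (hξ.measurable_top i).aemeasurable
    (StronglyMeasurable.of_discrete).aestronglyMeasurable, integral_fintype .of_finite]
  refine Finset.sum_congr rfl fun a _ => ?_
  rw [map_measureReal_apply (hξ.measurable_top i) (by trivial)]
  congr 1
  exact hξ.law i a

lemma memLp_comp [IsFiniteMeasure P] (hξ : IsIIDSample P μ ξ) {E : Type*}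
    [NormedAddCommGroup E] [MeasurableSpace E] [BorelSpace E] [SecondCountableTopology E]
    (f : A → E) (p : ENNReal) (i : ℕ) : MemLp (fun ω => f (ξ i ω)) p P :=
  MemLp.of_bound (hξ.measurable_comp f i).aestronglyMeasurable (∑ a, ‖f a‖)
    (Eventually.of_forall fun ω => Finset.single_le_sum (f := fun a => ‖f a‖)
      (fun _ _ => norm_nonneg _) (Finset.mem_univ (ξ i ω)))

variable [DecidableEq A]

/-- `F` may be arbitrary because the frequencies factor through the first N draws, which take values
in a finite discrete space. Hence the estimator need not be assumed measurable. -/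
lemma measurable_comp_sampleFreq (hξ : IsIIDSample P μ ξ) {E : Type*} [MeasurableSpace E]
    (F : (A → ℝ) → E) (N : ℕ) : Measurable fun ω => F (sampleFreq ξ N ω) := by
  let _ : MeasurableSpace A := ⊤
  have h1 : Measurable fun (ω : Ω) (i : Fin N) => ξ i ω :=
    measurable_pi_lambda _ fun i => hξ.measurable_top i
  let G : (Fin N → A) → A → ℝ := fun z a => ((Finset.univ.filter fun i => z i = a).card : ℝ) / N
  have h2 : (fun ω => F (sampleFreq ξ N ω)) = (F ∘ G) ∘ fun (ω : Ω) (i : Fin N) => ξ i ω := by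
    funext ω
    simp only [Function.comp_apply]
    congr 1
    funext a
    simp only [sampleFreq, G]
    congr 2
    rw [← Finset.card_map Fin.valEmbedding]
    congr 1
    ext i
    simp only [Finset.mem_filter, Finset.mem_range, Finset.mem_map, Finset.mem_univ, true_and,
      Fin.valEmbedding_apply]
    exact ⟨fun h => ⟨⟨i, h.1⟩, h.2, rfl⟩, fun ⟨j, hj, hji⟩ => hji ▸ ⟨j.2, hj⟩⟩
  rw [h2]
  exact (Measurable.of_discrete (f := F ∘ G)).comp h1

/-- **Law of large numbers** for observed frequencies. -/
lemma ae_tendsto_sampleFreq [IsProbabilityMeasure P] (hξ : IsIIDSample P μ ξ) :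
    ∀ᵐ ω ∂P, Tendsto (fun N => sampleFreq ξ N ω) atTop (𝓝 μ) := by
  have h : ∀ a, ∀ᵐ ω ∂P, Tendsto (fun N => sampleFreq ξ N ω a) atTop (𝓝 (μ a)) := fun a => by
    have hlaw := strong_law_ae_real (μ := P) (fun i ω => if ξ i ω = a then (1 : ℝ) else 0)
      ((hξ.memLp_comp (fun b => if b = a then (1 : ℝ) else 0) 1 0).integrable le_rfl)
      (fun i j hij => (hξ.iIndepFun_comp fun b => if b = a then (1 : ℝ) else 0).indepFun hij)
      (fun i => hξ.identDistrib_comp (fun b => if b = a then (1 : ℝ) else 0) i 0)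
    have hmean := hξ.integral_comp (fun b => if b = a then (1 : ℝ) else 0) 0
    simp only [smul_eq_mul, mul_ite, mul_one, mul_zero, Finset.sum_ite_eq', Finset.mem_univ,
      if_true] at hmean
    rw [hmean] at hlaw
    simp only [sum_range_ite_eq_card] at hlaw
    exact hlaw
  filter_upwards [ae_all_iff.2 h] with ω hω
  exact tendsto_pi_nhds.2 hω

lemma variance_comp [IsProbabilityMeasure P] (hξ : IsIIDSample P μ ξ) (t : A → ℝ) (i : ℕ) :
    Var[fun ω => t (ξ i ω); P] = t ⬝ᵥ (diagonal μ - vecMulVec μ μ) *ᵥ t := by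
  rw [variance_eq_sub (hξ.memLp_comp t 2 i)]
  have h1 := hξ.integral_comp (fun a => t a ^ 2) i
  have h2 := hξ.integral_comp t i
  simp only [smul_eq_mul] at h1 h2
  simp only [Pi.pow_apply]
  rw [h1, h2, sub_mulVec, dotProduct_sub, vecMulVec_mulVec]
  congr 1
  · simp only [dotProduct, mulVec_diagonal]
    exact Finset.sum_congr rfl fun a _ => by ring
  · simp only [dotProduct, Pi.smul_apply, MulOpposite.smul_eq_mul_unop, MulOpposite.unop_op,
      ← mul_assoc, ← Finset.sum_mul, sq]
    simp_rw [mul_comm (t _)]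

/-- Its quadratic form at `t` is the variance of `t` evaluated at one draw. -/
lemma posSemidef_covariance [IsProbabilityMeasure P] (hξ : IsIIDSample P μ ξ) :
    (diagonal μ - vecMulVec μ μ).PosSemidef := by
  refine PosSemidef.of_dotProduct_mulVec_nonneg ?_ fun t => ?_
  · ext a b
    simp only [conjTranspose_apply, Matrix.sub_apply, vecMulVec_apply, star_trivial]
    rw [← transpose_apply (diagonal μ), diagonal_transpose, mul_comm]
  · rw [star_trivial, ← hξ.variance_comp t 0]
    exact variance_nonneg _ _

/-- **Central limit theorem** for observed frequencies. -/
lemma tendstoInDistribution_sampleFreq [IsProbabilityMeasure P] (hξ : IsIIDSample P μ ξ) :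
    TendstoInDistribution
      (fun (N : ℕ) ω =>
        (WithLp.toLp 2 (√(N : ℝ) • (sampleFreq ξ N ω - μ)) : EuclideanSpace ℝ A)) atTop
      (id : EuclideanSpace ℝ A → EuclideanSpace ℝ A) (fun _ => P)
      (multivariateGaussian 0 (diagonal μ - vecMulVec μ μ)) := by
  let f : A → EuclideanSpace ℝ A := fun a => EuclideanSpace.single a 1
  have hmean : P[fun ω => f (ξ 0 ω)] = WithLp.toLp 2 μ := by
    rw [hξ.integral_comp f 0]
    ext b
    simp [f, Pi.single_apply]
  have := tendstoInDistribution_multivariateGaussian hξ.posSemidef_covariance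
    (hξ.memLp_comp f 2 0) (hξ.iIndepFun_comp f) (fun i => hξ.identDistrib_comp f i 0)
    fun t => by
      rw [← hξ.variance_comp t.ofLp 0]
      congr 1
      funext ω
      simp [f, EuclideanSpace.inner_single_right]
  rw [hmean] at this
  simpa only [sqrt_smul_sampleFreq_sub] using this

end IsIIDSample

end Sampling

/-! ### The Poisson regression of matching patterns -/

section Matching

open Matrix

lemma hhSize_pos {X Y : Type*} (a : Arrangement X Y) : 0 < hhSize a := by
  rcases a with a | a <;> norm_num [hhSize]

variable {X Y K : Type*} [Fintype X] [Fintype Y] [Fintype K] [DecidableEq X] [DecidableEq Y]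

section

variable (φ : Matrix (X × Y) K ℝ) (γ : ParamIdx K X Y → ℝ)

lemma design_mulVec_couple (x : X) (y : Y) :
    (design φ *ᵥ γ) (.inl (x, y)) =
      ((φ *ᵥ fun k => γ (.inl k)) (x, y) - γ (.inr (.inl x)) - γ (.inr (.inr y))) / 2 := by
  simp only [mulVec, dotProduct, Fintype.sum_sum_type, design, of_apply, ite_mul, zero_mul,
    Finset.sum_ite_eq, Finset.mem_univ, if_true, sub_div, Finset.sum_div]
  have : ∀ k, φ (x, y) k / 2 * γ (.inl k) = φ (x, y) k * γ (.inl k) / 2 := fun k => by ring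
  simp_rw [this]
  ring

lemma design_mulVec_single_man (x : X) :
    (design φ *ᵥ γ) (.inr (.inl x)) = -γ (.inr (.inl x)) := by
  simp [mulVec, dotProduct, Fintype.sum_sum_type, design]

lemma design_mulVec_single_woman (y : Y) :
    (design φ *ᵥ γ) (.inr (.inr y)) = -γ (.inr (.inr y)) := by
  simp [mulVec, dotProduct, Fintype.sum_sum_type, design]

end

variable {φ : Matrix (X × Y) K ℝ}

/-- The rows of singles recover a and b; the rows of couples then reduce to φβ, and the columns of φ
are independent. -/
lemma design_mulVec_injective (hφ : LinearIndependent ℝ φ.col) :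
    Function.Injective (design φ).mulVec := by
  refine (injective_iff_map_eq_zero (design φ).mulVecLin).2 fun γ hγ => ?_
  have h : ∀ a, (design φ *ᵥ γ) a = 0 := fun a => congrFun hγ a
  have hx : ∀ x, γ (.inr (.inl x)) = 0 := fun x => by
    have := h (.inr (.inl x)); rw [design_mulVec_single_man] at this; linarith
  have hy : ∀ y, γ (.inr (.inr y)) = 0 := fun y => by
    have := h (.inr (.inr y)); rw [design_mulVec_single_woman] at this; linarith
  have hk : (fun k => γ (.inl k)) = 0 := by
    refine mulVec_injective_iff.2 hφ ?_
    rw [mulVec_zero]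
    funext ⟨x, y⟩
    have := h (.inl (x, y))
    rw [design_mulVec_couple, hx, hy] at this
    simp only [Pi.zero_apply]
    linarith
  funext i
  rcases i with k | x | y
  exacts [congrFun hk k, hx x, hy y]

lemma matrixA_eq_sum (φ : Matrix (X × Y) K ℝ) (γ : ParamIdx K X Y → ℝ) :
    matrixA φ γ = ∑ a, (hhSize a * Real.exp ((design φ).mulVec γ a)) •
      vecMulVec (design φ a) (design φ a) := by
  ext i j
  rw [matrixA, weightMatrix, Matrix.mul_assoc _ (diagonal _) (diagonal _), diagonal_mul_diagonal,
    mul_apply, Matrix.sum_apply]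
  refine Finset.sum_congr rfl fun a _ => ?_
  rw [mul_diagonal, transpose_apply, Matrix.smul_apply, vecMulVec_apply, smul_eq_mul]
  ring

lemma matrixB_eq_sum {X Y K : Type*} [Fintype X] [Fintype Y] [DecidableEq X] [DecidableEq Y]
    (φ : Matrix (X × Y) K ℝ) (m : Arrangement X Y → ℝ) :
    matrixB φ m = ∑ a, (hhSize a ^ 2 * m a) • vecMulVec (design φ a) (design φ a) -
      ∑ a, ∑ a', (hhSize a * hhSize a' * m a * m a') •
        vecMulVec (design φ a) (design φ a') := by
  rw [matrixB, Matrix.mul_sub, Matrix.sub_mul, Matrix.sub_mul]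
  congr 1
  · ext i j
    rw [weightMatrix, Matrix.mul_assoc _ (diagonal _) (diagonal _), diagonal_mul_diagonal,
      Matrix.mul_assoc _ (diagonal _) (diagonal _), diagonal_mul_diagonal, mul_apply,
      Matrix.sum_apply]
    refine Finset.sum_congr rfl fun a _ => ?_
    rw [mul_diagonal, transpose_apply, Matrix.smul_apply, vecMulVec_apply, smul_eq_mul]
    ring
  · ext i j
    have hvec : m ᵥ* diagonal hhSize = fun a => m a * hhSize a :=
      funext fun a => vecMul_diagonal _ _ _
    rw [weightMatrix, mul_vecMulVec, vecMulVec_mul, vecMulVec_mul, hvec, vecMulVec_apply,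
      Matrix.sum_apply]
    simp only [Matrix.sum_apply, Matrix.smul_apply, vecMulVec_apply, smul_eq_mul, mulVec, vecMul, dotProduct, mul_diagonal, transpose_apply,
      Finset.sum_mul_sum]
    exact Finset.sum_congr rfl fun a _ => Finset.sum_congr rfl fun a' _ => by ring

lemma isPoissonSolution_iff {m : Arrangement X Y → ℝ} {γ : ParamIdx K X Y → ℝ} :
    IsPoissonSolution φ m γ ↔
      (design φ)ᵀ *ᵥ (fun a => hhSize a * m a) = fittedMoments (design φ) hhSize γ :=
  isMaxOn_weightedPoissonObjective_iff hhSize_pos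

lemma exists_isPoissonSolution (hφ : LinearIndependent ℝ φ.col) {m : Arrangement X Y → ℝ}
    (hm : ∀ a, 0 < m a) : ∃ γ, IsPoissonSolution φ m γ :=
  exists_isMaxOn_weightedPoissonObjective hhSize_pos hm (design_mulVec_injective hφ)

lemma IsPoissonSolution.unique (hφ : LinearIndependent ℝ φ.col) {m : Arrangement X Y → ℝ}
    {γ γ' : ParamIdx K X Y → ℝ} (h : IsPoissonSolution φ m γ) (h' : IsPoissonSolution φ m γ') :
    γ = γ' :=
  fittedMoments_injective hhSize_pos (design_mulVec_injective hφ)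
    ((isPoissonSolution_iff.1 h).symm.trans (isPoissonSolution_iff.1 h'))

/-- A stable matching of the Choo and Siow market is log-linear in the surplus and fixed effects. -/
lemma IsChooSiowStable.exists_eq_exp_design {β : K → ℝ} {μ : Arrangement X Y → ℝ}
    (hμ : ∀ a, 0 < μ a) (h : IsChooSiowStable (φ *ᵥ β) μ) :
    ∃ γ : ParamIdx K X Y → ℝ, (∀ k, γ (.inl k) = β k) ∧
      ∀ a, μ a = Real.exp ((design φ *ᵥ γ) a) := by
  -- The rows of singles force a_x = -log μ_x0 and b_y = -log μ_0y; the rows of couples are then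
  -- half the logarithm of the matching function.
  refine ⟨Sum.elim β (Sum.elim (fun x => -Real.log (μ (.inr (.inl x))))
    fun y => -Real.log (μ (.inr (.inr y)))), fun k => rfl, ?_⟩
  rintro (⟨x, y⟩ | x | y)
  · rw [design_mulVec_couple]
    simp only [Sum.elim_inl, Sum.elim_inr]
    have hsq := congrArg Real.log (h.sq_eq x y)
    rw [Real.log_pow, Real.log_mul (mul_pos (hμ _) (hμ _)).ne' (Real.exp_pos _).ne',
      Real.log_mul (hμ _).ne' (hμ _).ne', Real.log_exp] at hsq
    rw [← Real.exp_log (hμ (.inl (x, y)))]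
    congr 1
    push_cast at hsq
    change _ = ((φ *ᵥ β) (x, y) - _ - _) / 2
    linarith
  · rw [design_mulVec_single_man]
    simp [Real.exp_log (hμ _)]
  · rw [design_mulVec_single_woman]
    simp [Real.exp_log (hμ _)]

/-- Cramer's formula: the adjugate is polynomial in the entries and the limiting determinant is
nonzero. -/
lemma tendsto_matrix_inv {n α : Type*} [Fintype n] [DecidableEq n] {l : Filter α}
    {f : α → Matrix n n ℝ} {M : Matrix n n ℝ} (hf : Tendsto f l (𝓝 M)) (hM : IsUnit M.det) :
    Tendsto (fun x => (f x)⁻¹) l (𝓝 M⁻¹) := by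
  simp only [Matrix.inv_def, Ring.inverse_eq_inv']
  exact (((continuous_id.matrix_det.tendsto M).comp hf).inv₀ hM.ne_zero).smul
    ((continuous_id.matrix_adjugate.tendsto M).comp hf)

variable [DecidableEq K]

lemma tendsto_sandwich (hφ : LinearIndependent ℝ φ.col) {α : Type*} {l : Filter α}
    {γ : α → ParamIdx K X Y → ℝ} {m : α → Arrangement X Y → ℝ} {γ₀ : ParamIdx K X Y → ℝ}
    {μ : Arrangement X Y → ℝ} (hγ : Tendsto γ l (𝓝 γ₀)) (hm : Tendsto m l (𝓝 μ)) :
    Tendsto (fun x => sandwich φ (γ x) (m x)) l (𝓝 (sandwich φ γ₀ μ)) := by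
  have hA : Continuous (matrixA φ) := by
    have h1 : Continuous fun γ : ParamIdx K X Y → ℝ => design φ *ᵥ γ :=
      Continuous.matrix_mulVec continuous_const continuous_id
    have h2 : Continuous fun γ : ParamIdx K X Y → ℝ => fun a => Real.exp ((design φ *ᵥ γ) a) :=
      continuous_pi fun a => Real.continuous_exp.comp ((continuous_apply a).comp h1)
    exact (continuous_const.matrix_mul h2.matrix_diagonal).matrix_mul continuous_const
  have hB : Continuous (matrixB φ) :=
    ((continuous_const.matrix_mul (continuous_id.matrix_diagonal.sub
      (continuous_id.matrix_vecMulVec continuous_id))).matrix_mul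
        continuous_const).matrix_mul continuous_const
  have hinv := tendsto_matrix_inv ((hA.tendsto γ₀).comp hγ)
    (isUnit_det_poissonInformation hhSize_pos (design_mulVec_injective hφ) γ₀)
  exact (hinv.mul ((hB.tendsto μ).comp hm)).mul hinv

/-- The sandwich formula as the covariance matrix of the linearized estimator. -/
lemma sandwich_eq_mul_covariance_mul (φ : Matrix (X × Y) K ℝ) (γ : ParamIdx K X Y → ℝ)
    (m : Arrangement X Y → ℝ) :
    sandwich φ γ m = ((matrixA φ γ)⁻¹ * (design φ)ᵀ * weightMatrix X Y) *
      (diagonal m - vecMulVec m m) * ((matrixA φ γ)⁻¹ * (design φ)ᵀ * weightMatrix X Y)ᵀ := by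
  -- Symmetry of A lets the right factor A⁻¹ serve as the transpose of the left one.
  have hA : (matrixA φ γ)ᵀ = matrixA φ γ := poissonInformation_transpose
  rw [sandwich, matrixB, transpose_mul, transpose_mul, transpose_nonsing_inv, hA,
    transpose_transpose, weightMatrix, diagonal_transpose]
  simp only [Matrix.mul_assoc]

end Matching

theorem theorem2 {X Y K Ω : Type*} [Fintype X] [Fintype Y] [Fintype K]
    [DecidableEq X] [DecidableEq Y] [DecidableEq K] [MeasurableSpace Ω]
    (P : Measure Ω) [IsProbabilityMeasure P]
    (φ : Matrix (X × Y) K ℝ) (hφ : LinearIndependent ℝ φ.col)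
    (μ : Arrangement X Y → ℝ) (hμ_pos : ∀ a, 0 < μ a) (hμ_sum : ∑ a, μ a = 1)
    (ξ : ℕ → Ω → Arrangement X Y) (hξ : IsIIDSample P μ ξ)
    (γhat : (Arrangement X Y → ℝ) → ParamIdx K X Y → ℝ)
    (hγhat : ∀ m ∈ stdSimplex ℝ (Arrangement X Y),
      (∃ γ, IsPoissonSolution φ m γ) → IsPoissonSolution φ m (γhat m)) :
    -- the two matrices as sums over arrangements; the first one is always invertible
    (∀ γ : ParamIdx K X Y → ℝ, matrixA φ γ =
      ∑ a, (hhSize a * Real.exp ((design φ).mulVec γ a)) •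
        Matrix.vecMulVec (design φ a) (design φ a)) ∧
    (∀ m : Arrangement X Y → ℝ, matrixB φ m =
      ∑ a, (hhSize a ^ 2 * m a) • Matrix.vecMulVec (design φ a) (design φ a) -
        ∑ a, ∑ a', (hhSize a * hhSize a' * m a * m a') •
          Matrix.vecMulVec (design φ a) (design φ a')) ∧
    (∀ γ : ParamIdx K X Y → ℝ, IsUnit (matrixA φ γ).det) ∧
    -- almost surely, the Poisson regression has a solution in all large samples
    (∀ᵐ ω ∂P, ∀ᶠ N in atTop, ∃ γ, IsPoissonSolution φ (sampleFreq ξ N ω) γ) ∧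
    ∃ (γ₀ : ParamIdx K X Y → ℝ) (V : Matrix (ParamIdx K X Y) (ParamIdx K X Y) ℝ),
      -- `γ₀` is the estimand: the population solution, and the true parameter in the model
      (∀ γ, IsPoissonSolution φ μ γ ↔ γ = γ₀) ∧
      (∀ β : K → ℝ, IsChooSiowStable (φ.mulVec β) μ →
        (∀ k, γ₀ (.inl k) = β k) ∧ ∀ a, μ a = Real.exp ((design φ).mulVec γ₀ a)) ∧
      -- `V` is the asymptotic variance of the estimator, and the sandwich estimates it consistently
      HasAsymptoticVariance P (fun N ω => γhat (sampleFreq ξ N ω)) γ₀ V ∧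
      ∀ i j, TendstoInMeasure P
        (fun (N : ℕ) ω => sandwich φ (γhat (sampleFreq ξ N ω)) (sampleFreq ξ N ω) i j) atTop
        (fun _ => V i j) := by
  have hinj := design_mulVec_injective hφ
  obtain ⟨γ₀, hγ₀⟩ := exists_isPoissonSolution hφ hμ_pos
  have hμ_mem : μ ∈ stdSimplex ℝ (Arrangement X Y) := ⟨fun a => (hμ_pos a).le, hμ_sum⟩
  have hγhat_μ : γhat μ = γ₀ := (hγhat μ hμ_mem ⟨γ₀, hγ₀⟩).unique hφ hγ₀
  -- The derivative is taken within the simplex, the only place where `γhat` is constrained.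
  have hderiv : HasFDerivWithinAt γhat
      (matrixCLM ((matrixA φ γ₀)⁻¹ * (design φ).transpose * weightMatrix X Y))
      (stdSimplex ℝ (Arrangement X Y)) μ := by
    have := hasFDerivWithinAt_poissonRegression hhSize_pos hinj hμ_pos hμ_mem hγhat
    rw [hγhat_μ] at this
    exact this
  have hlln := hξ.ae_tendsto_sampleFreq
  -- At N = 0 division by zero gives the zero frequency vector, which lies outside the simplex.
  have hmem : ∀ᵐ ω ∂P, ∀ᶠ N in atTop, sampleFreq ξ N ω ∈ stdSimplex ℝ (Arrangement X Y) :=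
    Eventually.of_forall fun ω => (eventually_ne_atTop 0).mono fun N hN =>
      sampleFreq_mem_stdSimplex ξ hN ω
  refine ⟨matrixA_eq_sum φ, matrixB_eq_sum φ, isUnit_det_poissonInformation hhSize_pos hinj, ?_,
    γ₀, sandwich φ γ₀ μ, fun γ => ⟨fun h => h.unique hφ hγ₀, fun h => h ▸ hγ₀⟩, ?_, ⟨?_, ?_⟩, ?_⟩
  · filter_upwards [hlln] with ω hω
    -- By the law of large numbers every cell is eventually nonempty, which is enough for existence.
    have hpos : ∀ᶠ N in atTop, ∀ a, 0 < sampleFreq ξ N ω a := eventually_all.2 fun a =>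
      (tendsto_pi_nhds.1 hω a).eventually (lt_mem_nhds (hμ_pos a))
    exact hpos.mono fun N hN => exists_isPoissonSolution hφ hN
  · intro β hβ
    obtain ⟨γ, hγβ, hγμ⟩ := hβ.exists_eq_exp_design hμ_pos
    have hγ : γ = γ₀ := by
      refine IsPoissonSolution.unique hφ (isPoissonSolution_iff.2 ?_) hγ₀
      simp only [fittedMoments, ← hγμ]
    exact hγ ▸ ⟨hγβ, hγμ⟩
  · rw [sandwich_eq_mul_covariance_mul]
    simpa using hξ.posSemidef_covariance.mul_mul_conjTranspose_same
      ((matrixA φ γ₀)⁻¹ * (design φ).transpose * weightMatrix X Y)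
  · have hlim := tendstoInDistribution_comp_of_hasFDerivWithinAt hderiv
      (fun N : ℕ => Real.sqrt_nonneg N) hmem hlln
      (fun N => (hξ.measurable_comp_sampleFreq id N).aemeasurable)
      (fun N => (hξ.measurable_comp_sampleFreq γhat N).aemeasurable)
      hξ.tendstoInDistribution_sampleFreq
    rw [hγhat_μ] at hlim
    refine ⟨hlim.forall_aemeasurable, aemeasurable_id, ?_⟩
    convert! hlim.tendsto using 2
    refine congrArg 𝓝 (Subtype.ext ?_)
    simp only [Measure.map_id]
    rw [sandwich_eq_mul_covariance_mul,
      ← multivariateGaussian_map_mulVec hξ.posSemidef_covariance]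
    rfl
  · intro i j
    refine tendstoInMeasure_of_tendsto_ae (fun N =>
      (hξ.measurable_comp_sampleFreq (fun m => sandwich φ (γhat m) m i j) N).aestronglyMeasurable)
      ?_
    filter_upwards [hlln, hmem] with ω h1 h2
    -- Differentiability within the simplex yields continuity there, hence strong consistency of the
    -- estimator.
    have h3 : Tendsto (fun N => γhat (sampleFreq ξ N ω)) atTop (𝓝 γ₀) := by
      rw [← hγhat_μ]
      exact hderiv.continuousWithinAt.tendsto.comp (tendsto_nhdsWithin_iff.2 ⟨h1, h2⟩)
    exact tendsto_pi_nhds.1 (tendsto_pi_nhds.1 (tendsto_sandwich hφ h3 h1) i) j
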